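/- A $\Pi^0_1$ class is a class $\mathcal{C} \subseteq 2^\omega$ of the form $\mathcal{C} = \{X \in 2^\omega : (\forall n)\; X{\upharpoonright} n \notin W\}$ for some computably enumerable set $W \subseteq 2^{<\omega}$. A set $Q \subseteq \omega$ is of \emph{PA degree} if every non-empty $\Pi^0_1$ class $\mathcal{C} \subseteq 2^\omega$ has a member $X \in \mathcal{C}$ with $X \leq_T Q$. \textbf{Theorem (Liu).} For every set $A \subseteq \omega$, there is an infinite set $H$ with $H \subseteq A$ or $H \subseteq \overline{A} = \omega \setminus A$ such that $H$ is not of PA degree. -/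

import Mathlib

namespace Computability

/-- The initial segment `X ↾ n` of a binary sequence `X`, a binary string of length `n`. -/
def initSeg (X : ℕ → Bool) (n : ℕ) : List Bool :=
  (List.range n).map X

/-- A `Σ⁰₁` class in Cantor space: the set of all binary sequences that have an initial segment
in some fixed computably enumerable set `W` of binary strings. -/
def IsSigma01Class (U : Set (ℕ → Bool)) : Prop :=
  ∃ W : List Bool → Prop, REPred W ∧ U = {X | ∃ n, W (initSeg X n)}

/-- A `Π⁰₁` class in Cantor space: the complement of a `Σ⁰₁` class. -/
def IsPi01Class (C : Set (ℕ → Bool)) : Prop :=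
  IsSigma01Class Cᶜ

open Classical in
/-- The characteristic function of a set of natural numbers, as an oracle. -/
noncomputable def charOracle (Q : Set ℕ) : ℕ →. ℕ :=
  fun n => Part.some (if n ∈ Q then 1 else 0)

/-- The set `Q` computes the binary sequence `X`, that is, `X ≤_T Q`. -/
def Computes (Q : Set ℕ) (X : ℕ → Bool) : Prop :=
  ComputableIn {charOracle Q} X

/-- `Q` is of PA degree: it computes a member of every non-empty `Π⁰₁` class in `2^ω`. -/
def IsPADegree (Q : Set ℕ) : Prop :=
  ∀ C : Set (ℕ → Bool), IsPi01Class C → C.Nonempty → ∃ X ∈ C, Computes Q X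

end Computability

/-! No computable `X` avoids the partial computable function `diag` everywhere, so a set of PA
degree must compute a noncomputable member of the nonempty `Π⁰₁` class `diagAvoiding`. This settles
computable `A`: one of `A` and its complement is infinite and computable.

For noncomputable `A`, forcing builds infinite sets on both sides of the partition simultaneously,
and only one of them has to fail. If both computed members of `diagAvoiding`, the use principle
(`Computes.exists_graph`) would merge the two computations into one c.e. relation `E`. The generic
pair of `exists_generic` forces, on some side, either that `E` enumerates a value of `diag`, or that
`E` enumerates no value at some `n`. Both are impossible for the graph of a member of
`diagAvoiding`.

To decide `E`, consider the finite valuations `p` for which no splitting of the parts of a condition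
prevents every homogeneous set from making `E` contradict `p`. By compactness these form a c.e. set.
If it contains a `p` opposite to `diag`, the true partition `A` is one of the splittings that fail,
and a stem on the correct side can be extended to make `E` give a value of `diag`
(`exists_ext_of_correct`). Otherwise the set misses many pairwise incompatible valuations
(`exists_incompatible`). Overlaying a splitting for each and applying the pigeonhole principle gives
parts in which `E` can contradict neither of two incompatible valuations, hence has no value where
they differ (`exists_ext_of_incompatible`).

Infinitude comes from following acceptable parts, whose reservoirs can feed both sides. One always
exists, since otherwise Baire category would make `A` computable (`exists_acceptable`), and Kőnig's
lemma threads them into a branch. -/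

theorem Part.assert_dom_iff {p : Prop} : (Part.assert p fun _ => Part.some ()).Dom ↔ p := by
  simp [Part.dom_iff_mem, Part.mem_assert_iff]

/-! ### Computably enumerable predicates: normal form, closure properties, choice. -/

namespace REPred

variable {α β : Type*} [Primcodable α] [Primcodable β]

/-- Kleene normal form: a c.e. predicate is an unbounded search over an increasing sequence of
primitive recursive approximations. -/
theorem exists_primrec {p : α → Prop} (hp : REPred p) :
    ∃ T : α × ℕ → Bool, Primrec T ∧ (∀ a s t, s ≤ t → T (a, s) = true → T (a, t) = true) ∧
      ∀ a, p a ↔ ∃ s, T (a, s) = true := by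
  obtain ⟨c, hc⟩ := Nat.Partrec.Code.exists_code.1 hp
  refine ⟨fun x => (Nat.Partrec.Code.evaln x.2 c (Encodable.encode x.1)).isSome, ?_, ?_, ?_⟩
  · exact Primrec.option_isSome.comp (Nat.Partrec.Code.primrec_evaln.comp
      ((Primrec.snd.pair (Primrec.const c)).pair (Primrec.encode.comp Primrec.fst)))
  · intro a s t hst h
    rw [Option.isSome_iff_exists] at h ⊢
    obtain ⟨x, hx⟩ := h
    exact ⟨x, Nat.Partrec.Code.evaln_mono hst hx⟩
  · intro a
    have h1 : p a ↔ (c.eval (Encodable.encode a)).Dom := by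
      rw [hc]; simp [Part.assert_dom_iff]
    rw [h1, Part.dom_iff_mem]
    simp only [Nat.Partrec.Code.evaln_complete, Option.isSome_iff_exists]
    exact ⟨fun ⟨x, k, h⟩ => ⟨k, x, h⟩, fun ⟨k, x, h⟩ => ⟨x, k, h⟩⟩

theorem of_exists_computable {p : α → Prop} {T : α × ℕ → Bool} (hT : Computable T)
    (h : ∀ a, p a ↔ ∃ s, T (a, s) = true) : REPred p := by
  have : Partrec fun a => Nat.rfind fun s => (Part.some (T (a, s)) : Part Bool) :=
    Partrec.rfind (Computable.partrec hT)
  refine this.dom_re.of_eq fun a => ?_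
  refine (Nat.rfind_dom (p := fun s => Part.some (T (a, s)))).trans ?_
  simp [h]

theorem comp {p : β → Prop} (hp : REPred p) {f : α → β} (hf : Computable f) :
    REPred fun a => p (f a) :=
  Partrec.comp hp hf

theorem exists' {p : α × β → Prop} (hp : REPred p) : REPred fun a => ∃ b, p (a, b) := by
  obtain ⟨T, hT, -, h⟩ := hp.exists_primrec
  refine of_exists_computable (T := fun x => ((Encodable.decode (α := β) x.2.unpair.1).map
    fun b => T ((x.1, b), x.2.unpair.2)).getD false) ?_ ?_
  · refine Primrec.to_comp (Primrec.option_getD.comp (Primrec.option_map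
      (Primrec.decode.comp (Primrec.fst.comp (Primrec.unpair.comp Primrec.snd))) ?_)
      (Primrec.const false))
    exact hT.comp (Primrec.pair (Primrec.pair (Primrec.fst.comp Primrec.fst) Primrec.snd)
      (Primrec.snd.comp (Primrec.unpair.comp (Primrec.snd.comp Primrec.fst))))
  · intro a
    constructor
    · rintro ⟨b, hb⟩
      obtain ⟨s, hs⟩ := (h _).1 hb
      exact ⟨Nat.pair (Encodable.encode b) s, by simp [hs]⟩
    · rintro ⟨s, hs⟩
      rcases hd : Encodable.decode (α := β) s.unpair.1 with _ | b
      · simp [hd] at hs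
      · simp only [hd, Option.map_some, Option.getD_some] at hs
        exact ⟨b, (h _).2 ⟨_, hs⟩⟩

theorem and {p q : α → Prop} (hp : REPred p) (hq : REPred q) : REPred fun a => p a ∧ q a := by
  refine ((Partrec.bind hp ((Partrec.comp hq Computable.fst).to₂)).dom_re).of_eq fun a => ?_
  simp [Part.assert_dom_iff]

theorem or {p q : α → Prop} (hp : REPred p) (hq : REPred q) : REPred fun a => p a ∨ q a := by
  obtain ⟨T, hT, hm, h⟩ := hp.exists_primrec
  obtain ⟨T', hT', hm', h'⟩ := hq.exists_primrec
  refine of_exists_computable (T := fun x => T x || T' x) ?_ ?_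
  · exact (Primrec.or.comp hT hT').to_comp
  · intro a
    simp [h, h', exists_or]

/-- C.e. predicates are closed under quantification over a finite list. -/
theorem forall_mem_list {p : α × β → Prop} (hp : REPred p) {l : α → List β}
    (hl : Primrec l) : REPred fun a => ∀ b ∈ l a, p (a, b) := by
  obtain ⟨T, hT, hm, h⟩ := hp.exists_primrec
  have h1 : PrimrecPred fun x : α × ℕ => ∀ b ∈ l x.1, T ((x.1, b), x.2) = true := by
    have h0 : PrimrecRel fun (b : β) (x : α × ℕ) => T ((x.1, b), x.2) = true :=
      Primrec.eq.comp (hT.comp (Primrec.pair (Primrec.pair (Primrec.fst.comp Primrec.snd)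
        Primrec.fst) (Primrec.snd.comp Primrec.snd))) (Primrec.const true)
    exact h0.forall_mem_list.comp (hl.comp Primrec.fst) Primrec.id
  obtain ⟨hd, h1⟩ := h1
  refine of_exists_computable h1.to_comp fun a => ?_
  simp only [decide_eq_true_eq]
  constructor
  · intro H
    have H' : ∀ b ∈ l a, ∃ s, T ((a, b), s) = true := fun b hb => (h _).1 (H b hb)
    generalize l a = L at H'
    induction L with
    | nil => exact ⟨0, by simp⟩
    | cons c L ih =>
      obtain ⟨s, hs⟩ := ih fun b hb => H' b (List.mem_cons_of_mem _ hb)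
      obtain ⟨t, ht⟩ := H' c (List.mem_cons_self ..)
      refine ⟨max s t, fun b hb => ?_⟩
      rcases List.mem_cons.1 hb with rfl | hb
      · exact hm _ _ _ (le_max_right _ _) ht
      · exact hm _ _ _ (le_max_left _ _) (hs b hb)
  · rintro ⟨s, hs⟩ b hb
    exact (h _).2 ⟨s, hs b hb⟩

/-- A total c.e. relation has a computable choice function. -/
theorem exists_computable_choice {R : α × β → Prop} (hR : REPred R) (h : ∀ a, ∃ b, R (a, b)) :
    ∃ g : α → β, Computable g ∧ ∀ a, R (a, g a) := by
  obtain ⟨T, hT, -, hTR⟩ := hR.exists_primrec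
  -- The number `s` codes both a candidate `b` and a stage at which to test it, so one unbounded
  -- search covers all pairs.
  let f : α → ℕ → Option β := fun a s =>
    (Encodable.decode (α := β) s.unpair.1).bind fun b =>
      bif T ((a, b), s.unpair.2) then some b else none
  have hf : Primrec₂ f := by
    refine Primrec.option_bind
      (Primrec.decode.comp (Primrec.fst.comp (Primrec.unpair.comp Primrec.snd))) ?_
    refine Primrec.cond (hT.comp (Primrec.pair (Primrec.pair
      (Primrec.fst.comp Primrec.fst) Primrec.snd)
      (Primrec.snd.comp (Primrec.unpair.comp (Primrec.snd.comp Primrec.fst)))))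
      (Primrec.option_some.comp Primrec.snd) (Primrec.const none)
  have hfR : ∀ a s b, b ∈ f a s → R (a, b) := by
    intro a s b hb
    simp only [f, Option.mem_def, Option.bind_eq_some_iff] at hb
    obtain ⟨b', -, hb⟩ := hb
    cases hc : T ((a, b'), s.unpair.2) <;> simp [hc] at hb
    subst hb
    exact (hTR _).2 ⟨_, hc⟩
  have hdom : ∀ a, (Nat.rfindOpt (f a)).Dom := by
    intro a
    rw [Nat.rfindOpt_dom]
    obtain ⟨b, hb⟩ := h a
    obtain ⟨s, hs⟩ := (hTR _).1 hb
    exact ⟨Nat.pair (Encodable.encode b) s, b, by simp [f, hs]⟩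
  refine ⟨fun a => (Nat.rfindOpt (f a)).get (hdom a), ?_, fun a => ?_⟩
  · exact (Partrec.rfindOpt hf.to_comp).of_eq_tot fun a => Part.get_mem _
  · obtain ⟨s, hs⟩ := Nat.rfindOpt_spec (Part.get_mem (hdom a))
    exact hfR a s _ hs

/-- A predicate is determined by the partial recursive function that semidecides it, and codes are
countable. This lets the construction list all its requirements. -/
theorem countable : {p : α → Prop | REPred p}.Countable := by
  have : Countable {f : ℕ →. ℕ // Nat.Partrec f} := by
    refine (Function.Surjective.countable (f := fun c : Nat.Partrec.Code =>
      (⟨c.eval, Nat.Partrec.Code.exists_code.2 ⟨c, rfl⟩⟩ : {f : ℕ →. ℕ // Nat.Partrec f})) ?_)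
    rintro ⟨f, hf⟩
    obtain ⟨c, rfl⟩ := Nat.Partrec.Code.exists_code.1 hf
    exact ⟨c, rfl⟩
  refine Set.countable_coe_iff.1 (Function.Injective.countable
    (f := fun p : {p : α → Prop | REPred p} => (⟨_, p.2⟩ : {f : ℕ →. ℕ // Nat.Partrec f})) ?_)
  rintro ⟨p, hp⟩ ⟨q, hq⟩ h
  refine Subtype.ext (funext fun a => propext ?_)
  have := congrFun (congrArg Subtype.val h) (Encodable.encode a)
  simpa [Part.assert_dom_iff] using congrArg Part.Dom this

end REPred

/-! ### The use principle for oracle computations. -/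

namespace Computability

@[simp]
theorem initSeg_length (X : ℕ → Bool) (n : ℕ) : (initSeg X n).length = n := by
  simp [initSeg]

theorem initSeg_congr {G G' : ℕ → Bool} {k : ℕ} : initSeg G k = initSeg G' k ↔
    ∀ i < k, G i = G' i := by
  simp [initSeg]

/-- A monotone family of partial functions with pointwise union `f`. -/
def Approximates (g : ℕ → ℕ →. ℕ) (f : ℕ →. ℕ) : Prop :=
  (∀ k l n y, k ≤ l → y ∈ g k n → y ∈ g l n) ∧ ∀ n y, y ∈ f n ↔ ∃ k, y ∈ g k n

namespace Approximates

variable {f h : ℕ →. ℕ} {F H : ℕ → ℕ →. ℕ}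

theorem const (f : ℕ →. ℕ) : Approximates (fun _ => f) f :=
  ⟨fun _ _ _ _ _ h => h, fun _ _ => by simp⟩

theorem pair (hf : Approximates F f) (hh : Approximates H h) :
    Approximates (fun k n => Nat.pair <$> F k n <*> H k n)
      (fun n => Nat.pair <$> f n <*> h n) := by
  constructor
  · intro k l n y hkl
    simp only [Seq.seq, Part.map_eq_map, Part.bind_map, Part.mem_bind_iff, Part.mem_map_iff]
    rintro ⟨a, ha, b, hb, rfl⟩
    exact ⟨a, hf.1 k l _ _ hkl ha, b, hh.1 k l _ _ hkl hb, rfl⟩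
  · intro n y
    simp only [Seq.seq, Part.map_eq_map, Part.bind_map, Part.mem_bind_iff, Part.mem_map_iff]
    constructor
    · rintro ⟨a, ha, b, hb, rfl⟩
      obtain ⟨k, hk⟩ := (hf.2 _ _).1 ha
      obtain ⟨l, hl⟩ := (hh.2 _ _).1 hb
      exact ⟨max k l, a, hf.1 _ _ _ _ (le_max_left _ _) hk, b,
        hh.1 _ _ _ _ (le_max_right _ _) hl, rfl⟩
    · rintro ⟨k, a, ha, b, hb, rfl⟩
      exact ⟨a, (hf.2 _ _).2 ⟨k, ha⟩, b, (hh.2 _ _).2 ⟨k, hb⟩, rfl⟩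

theorem comp (hf : Approximates F f) (hh : Approximates H h) :
    Approximates (fun k n => (H k n).bind fun a => F k a) (fun n => (h n).bind fun a => f a) := by
  constructor
  · intro k l n y hkl
    simp only [Part.mem_bind_iff]
    rintro ⟨a, ha, hy⟩
    exact ⟨a, hh.1 k l _ _ hkl ha, hf.1 k l _ _ hkl hy⟩
  · intro n y
    simp only [Part.mem_bind_iff]
    constructor
    · rintro ⟨a, ha, hy⟩
      obtain ⟨k, hk⟩ := (hh.2 _ _).1 ha
      obtain ⟨l, hl⟩ := (hf.2 _ _).1 hy
      exact ⟨max k l, a, hh.1 _ _ _ _ (le_max_left _ _) hk,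
        hf.1 _ _ _ _ (le_max_right _ _) hl⟩
    · rintro ⟨k, a, ha, hy⟩
      exact ⟨a, (hh.2 _ _).2 ⟨k, ha⟩, (hf.2 _ _).2 ⟨k, hy⟩⟩

/-- Primitive recursion on partial functions. -/
def primRec (f h : ℕ →. ℕ) (a n : ℕ) : Part ℕ :=
  n.rec (f a) fun y IH => IH.bind fun i => h (Nat.pair a (Nat.pair y i))

theorem primRec_mono (hf : Approximates F f) (hh : Approximates H h) {k l : ℕ} (hkl : k ≤ l)
    (a n y : ℕ) : y ∈ primRec (F k) (H k) a n → y ∈ primRec (F l) (H l) a n := by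
  induction n generalizing y with
  | zero => exact hf.1 _ _ _ _ hkl
  | succ n ih =>
    simp only [primRec, Part.mem_bind_iff]
    rintro ⟨i, hi, hy⟩
    exact ⟨i, ih i hi, hh.1 _ _ _ _ hkl hy⟩

theorem mem_primRec (hf : Approximates F f) (hh : Approximates H h) (a n y : ℕ) :
    y ∈ primRec f h a n ↔ ∃ k, y ∈ primRec (F k) (H k) a n := by
  induction n generalizing y with
  | zero => exact hf.2 _ _
  | succ n ih =>
    simp only [primRec, Part.mem_bind_iff]
    constructor
    · rintro ⟨i, hi, hy⟩
      obtain ⟨k, hk⟩ := (ih i).1 hi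
      obtain ⟨l, hl⟩ := (hh.2 _ _).1 hy
      exact ⟨max k l, i, primRec_mono hf hh (le_max_left _ _) _ _ _ hk,
        hh.1 _ _ _ _ (le_max_right _ _) hl⟩
    · rintro ⟨k, i, hi, hy⟩
      exact ⟨i, (ih i).2 ⟨k, hi⟩, (hh.2 _ _).2 ⟨k, hy⟩⟩

theorem prec (hf : Approximates F f) (hh : Approximates H h) :
    Approximates (fun k p => primRec (F k) (H k) p.unpair.1 p.unpair.2)
      (fun p => primRec f h p.unpair.1 p.unpair.2) :=
  ⟨fun _ _ _ _ hkl => primRec_mono hf hh hkl _ _ _, fun _ _ => mem_primRec hf hh _ _ _⟩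

/-- Unbounded search for a zero. -/
def search (f : ℕ →. ℕ) (a : ℕ) : Part ℕ :=
  Nat.rfind fun n => (fun m => decide (m = 0)) <$> f (Nat.pair a n)

theorem mem_search (f : ℕ →. ℕ) (a n : ℕ) : n ∈ search f a ↔
    0 ∈ f (Nat.pair a n) ∧ ∀ m < n, ∃ y, y ≠ 0 ∧ y ∈ f (Nat.pair a m) := by
  refine Nat.mem_rfind.trans ?_
  simp [and_comm]

theorem rfind (hf : Approximates F f) : Approximates (fun k a => search (F k) a)
    (fun a => search f a) := by
  constructor
  · intro k l a n hkl
    simp only [mem_search]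
    rintro ⟨h0, h⟩
    exact ⟨hf.1 _ _ _ _ hkl h0, fun m hm => (h m hm).imp fun y hy => ⟨hy.1, hf.1 _ _ _ _ hkl hy.2⟩⟩
  · intro a n
    simp only [mem_search]
    constructor
    · rintro ⟨h0, h⟩
      obtain ⟨k0, hk0⟩ := (hf.2 _ _).1 h0
      -- A successful search consults only finitely many values, so a single stage supplies them
      -- all.
      have : ∃ k, ∀ m < n, ∃ y, y ≠ 0 ∧ y ∈ F k (Nat.pair a m) := by
        clear h0 hk0
        induction n with
        | zero => exact ⟨0, by simp⟩
        | succ n ih =>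
          obtain ⟨k, hk⟩ := ih fun m hm => h m (hm.trans n.lt_succ_self)
          obtain ⟨y, hy0, hy⟩ := h n n.lt_succ_self
          obtain ⟨l, hl⟩ := (hf.2 _ _).1 hy
          refine ⟨max k l, fun m hm => ?_⟩
          rcases Nat.lt_succ_iff_lt_or_eq.1 hm with hm | rfl
          · exact (hk m hm).imp fun y hy => ⟨hy.1, hf.1 _ _ _ _ (le_max_left _ _) hy.2⟩
          · exact ⟨y, hy0, hf.1 _ _ _ _ (le_max_right _ _) hl⟩
      obtain ⟨k, hk⟩ := this
      exact ⟨max k0 k, hf.1 _ _ _ _ (le_max_left _ _) hk0, fun m hm =>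
        (hk m hm).imp fun y hy => ⟨hy.1, hf.1 _ _ _ _ (le_max_right _ _) hy.2⟩⟩
    · rintro ⟨k, h0, h⟩
      exact ⟨(hf.2 _ _).2 ⟨k, h0⟩, fun m hm =>
        (h m hm).imp fun y hy => ⟨hy.1, (hf.2 _ _).2 ⟨k, hy.2⟩⟩⟩

end Approximates

open Approximates in
/-- The use principle: a function recursive in an oracle is the union of its values computed
from initial segments of the oracle, uniformly effectively in the segments. -/
theorem exists_approximation (Q : ℕ → Bool) {f : ℕ →. ℕ}
    (hf : Nat.RecursiveIn {fun n => Part.some (Q n).toNat} f) :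
    ∃ ψ : List Bool → ℕ →. ℕ, Partrec₂ ψ ∧ Approximates (fun k => ψ (initSeg Q k)) f := by
  have of_partrec : ∀ {g : ℕ →. ℕ}, Nat.Partrec g →
      ∃ ψ : List Bool → ℕ →. ℕ, Partrec₂ ψ ∧ Approximates (fun k => ψ (initSeg Q k)) g :=
    fun {g} hg => ⟨fun _ => g, (Partrec.comp (Partrec.nat_iff.2 hg) Computable.snd).to₂, const g⟩
  induction hf with
  | zero => exact of_partrec .zero
  | succ => exact of_partrec .succ
  | left => exact of_partrec .left
  | right => exact of_partrec .right
  | oracle g hg =>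
    obtain rfl : g = _ := hg
    -- An oracle query is answered by the string and diverges past its end.
    refine ⟨fun τ n => ((τ[n]?).map Bool.toNat : Option ℕ), ?_, ?_, ?_⟩
    · exact Computable.ofOption (Computable.option_map
        (Computable.list_getElem?.comp Computable.fst Computable.snd)
        ((Primrec.dom_bool Bool.toNat).to_comp.comp Computable.snd).to₂)
    · intro k l n y hkl
      simp only [initSeg, Part.mem_ofOption, List.getElem?_map, Option.mem_def,
        Option.map_eq_some_iff, List.getElem?_eq_some_iff, List.length_range, List.getElem_range]
      rintro ⟨b, ⟨c, ⟨hc, rfl⟩, rfl⟩, rfl⟩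
      exact ⟨_, ⟨_, ⟨hc.trans_le hkl, rfl⟩, rfl⟩, rfl⟩
    · intro n y
      simp only [initSeg, Part.mem_ofOption, List.getElem?_map, Option.mem_def, Part.mem_some_iff,
        Option.map_eq_some_iff, List.getElem?_eq_some_iff, List.length_range, List.getElem_range]
      constructor
      · rintro rfl
        exact ⟨n + 1, _, ⟨_, ⟨n.lt_succ_self, rfl⟩, rfl⟩, rfl⟩
      · rintro ⟨k, b, ⟨c, ⟨hc, rfl⟩, rfl⟩, rfl⟩
        rfl
  | pair _ _ ih₁ ih₂ =>
    obtain ⟨ψ, hψ, h⟩ := ih₁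
    obtain ⟨ψ', hψ', h'⟩ := ih₂
    refine ⟨fun τ n => Nat.pair <$> ψ τ n <*> ψ' τ n, ?_, h.pair h'⟩
    have : Partrec fun x : List Bool × ℕ => (ψ x.1 x.2).bind fun a =>
        (ψ' x.1 x.2).map fun b => Nat.pair a b :=
      Partrec.bind hψ ((Partrec.map (Partrec.comp hψ' Computable.fst)
        (Primrec₂.natPair.to_comp.comp (Computable.snd.comp Computable.fst)
          Computable.snd).to₂).to₂)
    exact this.of_eq fun x => by simp [Seq.seq, Part.bind_map]
  | comp _ _ ih₁ ih₂ =>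
    obtain ⟨ψ, hψ, h⟩ := ih₁
    obtain ⟨ψ', hψ', h'⟩ := ih₂
    refine ⟨fun τ n => (ψ' τ n).bind (ψ τ), ?_, h.comp h'⟩
    exact Partrec.bind hψ' (hψ.comp (Computable.fst.comp Computable.fst) Computable.snd).to₂
  | prec _ _ ih₁ ih₂ =>
    obtain ⟨ψ, hψ, h⟩ := ih₁
    obtain ⟨ψ', hψ', h'⟩ := ih₂
    refine ⟨fun τ p => primRec (ψ τ) (ψ' τ) p.unpair.1 p.unpair.2, ?_, h.prec h'⟩
    have u : Computable fun x : List Bool × ℕ => x.2.unpair :=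
      Computable.unpair.comp Computable.snd
    refine (Partrec.nat_rec (f := fun x : List Bool × ℕ => x.2.unpair.2)
      (g := fun x => ψ x.1 x.2.unpair.1)
      (h := fun x z => ψ' x.1 (Nat.pair x.2.unpair.1 (Nat.pair z.1 z.2)))
      (Computable.snd.comp u) (hψ.comp Computable.fst (Computable.fst.comp u)) ?_)
    exact (hψ'.comp (Computable.fst.comp Computable.fst) (Primrec₂.natPair.to_comp.comp
      ((Computable.fst.comp u).comp Computable.fst) (Primrec₂.natPair.to_comp.comp
        (Computable.fst.comp Computable.snd) (Computable.snd.comp Computable.snd)))).to₂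
  | rfind _ ih =>
    obtain ⟨ψ, hψ, h⟩ := ih
    refine ⟨fun τ a => search (ψ τ) a, ?_, h.rfind⟩
    refine Partrec.rfind (p := fun (x : List Bool × ℕ) n =>
      (fun m => decide (m = 0)) <$> ψ x.1 (Nat.pair x.2 n)) ?_
    refine Partrec.map (hψ.comp (Computable.fst.comp Computable.fst)
      (Primrec₂.natPair.to_comp.comp (Computable.snd.comp Computable.fst) Computable.snd)) ?_
    exact ((Primrec.eq.comp Primrec.snd (Primrec.const 0)).decide.to_comp).to₂

/-- The graph of a binary sequence computed by `Q` is enumerated from initial segments of `Q`. -/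
theorem Computes.exists_graph {G : ℕ → Bool} {X : ℕ → Bool}
    (h : Computes {n | G n = true} X) :
    ∃ E : List Bool × ℕ × Bool → Prop, REPred E ∧
      ∀ n b, X n = b ↔ ∃ k, E (initSeg G k, n, b) := by
  have e : charOracle {n | G n = true} = fun n => Part.some (G n).toNat := by
    funext n
    cases hG : G n <;> simp [charOracle, hG]
  rw [Computes, e] at h
  obtain ⟨ψ, hψ, hX⟩ := exists_approximation G h
  refine ⟨fun x => Encodable.encode x.2.2 ∈ ψ x.1 x.2.1, ?_, fun n b => ?_⟩
  · have h1 : Partrec fun x : List Bool × ℕ × Bool => ψ x.1 x.2.1 :=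
      hψ.comp Computable.fst (Computable.fst.comp Computable.snd)
    have h2 : REPred fun y : (List Bool × ℕ × Bool) × ℕ => Encodable.encode y.1.2.2 = y.2 :=
      (Primrec.eq.comp (Primrec.encode.comp (Primrec.snd.comp (Primrec.snd.comp Primrec.fst)))
        Primrec.snd).computablePred.to_re
    refine ((Partrec.bind h1 (Partrec.to₂ h2)).dom_re).of_eq fun x => ?_
    simp only [Part.dom_iff_mem, Part.mem_bind_iff, Part.mem_assert_iff]
    constructor
    · rintro ⟨-, a, ha, hx, -⟩
      rwa [hx]
    · exact fun h => ⟨(), _, h, rfl, by simp⟩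
  · refine Iff.trans ?_ (hX.2 n (Encodable.encode b))
    simp [Encodable.encode_inj, eq_comm]

end Computability

/-! ### Effectively closed classes of colorings and compactness. -/

namespace Computability

variable {P P' α β : Type} [Primcodable P] [Primcodable P'] [Primcodable α] [Primcodable β]

/-- The initial segment of length `n` of a sequence `X`. -/
def seg {α : Type} (X : ℕ → α) (n : ℕ) : List α :=
  (List.range n).map X

theorem seg_getElem?_eq_some {α : Type} {X : ℕ → α} {n i : ℕ} {a : α} :
    (seg X n)[i]? = some a ↔ i < n ∧ X i = a := by
  simp [seg, List.getElem?_eq_some_iff]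

theorem seg_take {α : Type} (X : ℕ → α) (n i : ℕ) : (seg X n).take i = seg X (min i n) := by
  simp [seg, ← List.map_take, List.take_range]

theorem seg_congr {α : Type} {X Y : ℕ → α} {n : ℕ} : seg X n = seg Y n ↔ ∀ i < n, X i = Y i := by
  simp [seg]

/-- `C` is a family of effectively closed classes, uniformly in the parameter. -/
def EffClosed (C : P → Set (ℕ → α)) : Prop :=
  ∃ W : P × List α → Prop, REPred W ∧ ∀ p, C p = {X | ∀ k, ¬ W (p, seg X k)}

/-- Membership in a fixed finite list is a primitive recursive predicate. -/
theorem primrecPred_mem_list (l : List α) : PrimrecPred fun a => a ∈ l := by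
  have : PrimrecRel fun (L : List α) (a : α) => ∃ b ∈ L, b = a :=
    PrimrecRel.exists_mem_list Primrec.eq
  exact (this.comp (Primrec.const l) Primrec.id).of_eq fun a => by simp

theorem primrecPred_finite [Finite α] (p : α → Prop) : PrimrecPred p := by
  classical exact ⟨fun _ => Classical.dec _, Primrec.dom_finite _⟩

namespace EffClosed

theorem congr {C D : P → Set (ℕ → α)} (h : EffClosed C) (e : ∀ p, C p = D p) : EffClosed D :=
  (funext e : C = D) ▸ h

theorem param {C : P → Set (ℕ → α)} (h : EffClosed C) {g : P' → P} (hg : Computable g) :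
    EffClosed fun p => C (g p) := by
  obtain ⟨W, hW, hC⟩ := h
  exact ⟨fun x => W (g x.1, x.2),
    hW.comp ((hg.comp Computable.fst).pair Computable.snd), fun p => hC _⟩

theorem preimage {C : P → Set (ℕ → β)} (h : EffClosed C) {f : α → β} (hf : Primrec f) :
    EffClosed fun p => {X : ℕ → α | f ∘ X ∈ C p} := by
  obtain ⟨W, hW, hC⟩ := h
  refine ⟨fun x => W (x.1, x.2.map f), hW.comp (Computable.fst.pair
    (Primrec.list_map Primrec.snd (hf.comp Primrec.snd).to₂).to_comp), fun p => ?_⟩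
  simp [hC, seg]

theorem univ : EffClosed fun _ : P => (Set.univ : Set (ℕ → α)) :=
  ⟨fun _ => False, ((Primrec.eq.comp (Primrec.const 0) (Primrec.const 1)).computablePred.to_re).of_eq
    (by simp), fun _ => by simp⟩

theorem inter {C D : P → Set (ℕ → α)} (hC : EffClosed C) (hD : EffClosed D) :
    EffClosed fun p => C p ∩ D p := by
  obtain ⟨W, hW, hC⟩ := hC
  obtain ⟨V, hV, hD⟩ := hD
  refine ⟨fun x => W x ∨ V x, hW.or hV, fun p => ?_⟩
  ext X
  simp [hC, hD, not_or, forall_and]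

theorem iInter {ι : Type} [Finite ι] {C : ι → P → Set (ℕ → α)} (hC : ∀ i, EffClosed (C i)) :
    EffClosed fun p => ⋂ i, C i p := by
  classical
  have := Fintype.ofFinite ι
  have key : ∀ s : Finset ι, EffClosed fun p => ⋂ i ∈ s, C i p := by
    intro s
    induction s using Finset.induction_on with
    | empty => simpa using univ
    | insert i s _ ih => exact ((hC i).inter ih).congr fun p => by simp
  simpa using key Finset.univ

theorem forall_not {R : P × ℕ × α → Prop} (hR : REPred R) :
    EffClosed fun p => {X : ℕ → α | ∀ n, ¬ R (p, n, X n)} := by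
  refine ⟨fun x => ∃ y : ℕ × α, x.2[y.1]? = some y.2 ∧ R (x.1, y), ?_, fun p => ?_⟩
  · refine REPred.exists' (REPred.and ?_ ?_) (p := fun z : (P × List α) × ℕ × α =>
      z.1.2[z.2.1]? = some z.2.2 ∧ R (z.1.1, z.2))
    · exact (Primrec.eq.comp (Primrec.list_getElem?.comp (Primrec.snd.comp Primrec.fst)
        (Primrec.fst.comp Primrec.snd)) (Primrec.option_some.comp
          (Primrec.snd.comp Primrec.snd))).computablePred.to_re
    · exact hR.comp ((Computable.fst.comp Computable.fst).pair Computable.snd)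
  · ext X
    simp only [Set.mem_ofPred_eq, seg_getElem?_eq_some, Prod.exists]
    constructor
    · rintro h k ⟨n, a, ⟨-, rfl⟩, hR⟩
      exact h n hR
    · exact fun h n hR => h (n + 1) ⟨n, _, ⟨n.lt_succ_self, rfl⟩, hR⟩

theorem cylinder (X : ℕ → α) (N : ℕ) :
    EffClosed fun _ : P => {Y : ℕ → α | seg Y N = seg X N} := by
  classical
  -- `X` need not be computable; only its finite table below `N` is used as data.
  have hl : ∀ n a, (n, a) ∈ (List.range N).map (fun n => (n, X n)) ↔ n < N ∧ X n = a := by simp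
  refine EffClosed.congr (forall_not (R := fun x : P × ℕ × α =>
    x.2.1 < N ∧ x.2 ∉ (List.range N).map fun n => (n, X n)) ?_) fun p => ?_
  · exact (PrimrecPred.and (Primrec.nat_lt.comp (Primrec.fst.comp Primrec.snd) (Primrec.const N))
      ((primrecPred_mem_list _).comp Primrec.snd).not).computablePred.to_re
  · ext Y
    simp only [Set.mem_ofPred_eq, seg_congr, hl]
    refine forall_congr' fun n => ?_
    by_cases h : n < N <;> simp [h, eq_comm]

end EffClosed

/-- All strings of length `k` over a finite alphabet listed by `A`. -/
def strings {α : Type} (A : List α) (k : ℕ) : List (List α) :=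
  k.rec [[]] fun _ L => L.flatMap fun σ => A.map fun a => σ ++ [a]

theorem primrec_strings (A : List α) : Primrec (strings A) := by
  refine Primrec.nat_rec₁ _ ?_
  refine Primrec.list_flatMap Primrec.snd ?_
  exact Primrec.list_map (Primrec.const A)
    (Primrec.list_concat.comp (Primrec.snd.comp Primrec.fst) Primrec.snd).to₂

theorem length_of_mem_strings {α : Type} {A : List α} {k : ℕ} {σ : List α}
    (h : σ ∈ strings A k) : σ.length = k := by
  induction k generalizing σ with
  | zero => simpa [strings] using h
  | succ k ih =>
    obtain ⟨τ, hτ, h⟩ := List.mem_flatMap.1 h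
    obtain ⟨a, -, rfl⟩ := List.mem_map.1 h
    simp [ih hτ]

theorem seg_mem_strings {α : Type} {A : List α} (hA : ∀ a, a ∈ A) (X : ℕ → α) (k : ℕ) :
    seg X k ∈ strings A k := by
  induction k with
  | zero => simp [strings, seg]
  | succ k ih =>
    refine List.mem_flatMap.2 ⟨_, ih, List.mem_map.2 ⟨X k, hA _, ?_⟩⟩
    simp [seg, List.range_succ]

theorem isClosed_seg {α : Type} [TopologicalSpace α] [DiscreteTopology α] (W : List α → Prop)
    (i : ℕ) : IsClosed {X : ℕ → α | W (seg X i)} := by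
  have hc : Continuous fun X : ℕ → α => fun j : Fin i => X j :=
    continuous_pi fun j => continuous_apply _
  have : {X : ℕ → α | W (seg X i)} =
      (fun X : ℕ → α => fun j : Fin i => X j) ⁻¹' {x | W (List.ofFn x)} := by
    ext X
    have : seg X i = List.ofFn fun j : Fin i => X j :=
      List.ext_getElem (by simp [seg]) fun n _ _ => by simp [seg]
    simp [this]
  rw [this]
  exact (isClosed_discrete _).preimage hc

theorem EffClosed.isClosed [TopologicalSpace α] [DiscreteTopology α] {C : P → Set (ℕ → α)}
    (h : EffClosed C) (p : P) : IsClosed (C p) := by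
  obtain ⟨W, -, hC⟩ := h
  have : C p = ⋂ k, {X | ¬ W (p, seg X k)} := by
    ext X; simp [hC]
  rw [this]
  exact isClosed_iInter fun k => isClosed_seg (fun σ => ¬ W (p, σ)) k

/-- Compactness: if an effectively closed class has no members, this is witnessed at a finite
level. -/
theorem exists_level_of_forall_exists {α : Type} [Finite α] {A : List α} {W : List α → Prop}
    (h : ∀ k, ∃ σ ∈ strings A k, ∀ i, ¬ W (σ.take i)) : ∃ X : ℕ → α, ∀ k, ¬ W (seg X k) := by
  let _ : TopologicalSpace α := ⊥
  have : DiscreteTopology α := ⟨rfl⟩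
  obtain ⟨a₀⟩ : Nonempty α := by
    obtain ⟨σ, hσ, -⟩ := h 1
    have := length_of_mem_strings hσ
    cases σ with
    | nil => simp at this
    | cons a _ => exact ⟨a⟩
  let K : ℕ → Set (ℕ → α) := fun k => {X | ∀ i ≤ k, ¬ W (seg X i)}
  have hclosed : ∀ k, IsClosed (K k) := by
    intro k
    have : K k = ⋂ i ∈ Set.Iic k, {X | ¬ W (seg X i)} := by
      ext X; simp [K]
    rw [this]
    exact isClosed_biInter fun i _ => isClosed_seg (fun σ => ¬ W σ) i
  have hne : ∀ k, (K k).Nonempty := by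
    intro k
    obtain ⟨σ, hσ, hW⟩ := h k
    have hl := length_of_mem_strings hσ
    refine ⟨fun n => σ.getD n a₀, fun i hi => ?_⟩
    have : seg (fun n => σ.getD n a₀) i = σ.take i := by
      refine List.ext_getElem (by simp [seg, hl, hi]) fun n h1 h2 => ?_
      simp only [List.length_take] at h2
      have : n < σ.length := by omega
      simp [seg, this]
    rw [this]
    exact hW i
  obtain ⟨X, hX⟩ := IsCompact.nonempty_iInter_of_sequence_nonempty_isCompact_isClosed K
    (fun k X hX i hi => hX i (hi.trans k.le_succ)) hne (hclosed 0).isCompact hclosed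
  exact ⟨X, fun k => (Set.mem_iInter.1 hX k) k le_rfl⟩

/-- Emptiness of effectively closed classes over a finite alphabet is c.e. -/
theorem EffClosed.rePred_eq_empty [Finite α] {C : P → Set (ℕ → α)} (h : EffClosed C) :
    REPred fun p => C p = ∅ := by
  have := Fintype.ofFinite α
  obtain ⟨W, hW, hC⟩ := h
  let A : List α := Finset.univ.toList
  have h1 : REPred fun x : (P × ℕ) × List α => ∃ i, W (x.1.1, x.2.take i) :=
    REPred.exists' (p := fun y : ((P × ℕ) × List α) × ℕ => W (y.1.1.1, y.1.2.take y.2))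
      (hW.comp ((Computable.fst.comp (Computable.fst.comp Computable.fst)).pair
        (Primrec.list_take.comp Primrec.snd (Primrec.snd.comp Primrec.fst)).to_comp))
  have h2 : REPred fun x : P × ℕ => ∀ σ ∈ strings A x.2, ∃ i, W (x.1, σ.take i) :=
    h1.forall_mem_list ((primrec_strings A).comp Primrec.snd)
  refine h2.exists'.of_eq fun p => ?_
  constructor
  · rintro ⟨k, hk⟩
    rw [Set.eq_empty_iff_forall_notMem]
    intro X hX
    obtain ⟨i, hi⟩ := hk _ (seg_mem_strings (fun a => by simp [A]) X k)
    rw [hC] at hX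
    rw [seg_take] at hi
    exact hX _ hi
  · intro he
    by_contra hcon
    push Not at hcon
    obtain ⟨X, hX⟩ := exists_level_of_forall_exists (W := fun σ => W (p, σ)) hcon
    have : X ∈ C p := by rw [hC]; exact hX
    simp [he] at this

/-- `G` is an extension of `f ↾ N` by elements of color `c` under `X`. -/
def Agrees {β : Type} (f : ℕ → Bool) (N : ℕ) (X : ℕ → β) (c : β) (G : ℕ → Bool) : Prop :=
  (∀ i < N, G i = f i) ∧ ∀ i, N ≤ i → G i = true → X i = c

/-- The class of colorings of which no homogeneous set meets the c.e. condition `R`. -/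
theorem EffClosed.forall_agrees [Finite β] (f : β → ℕ → Bool) (N : ℕ)
    {R : P × β × List Bool → Prop} (hR : REPred R) :
    EffClosed fun p => {X : ℕ → β | ∀ c G, Agrees (f c) N X c G → ∀ k, ¬ R (p, c, initSeg G k)} := by
  classical
  have := Fintype.ofFinite β
  -- Since `f` need not be computable, its values below `N` are hard-coded in a finite table.
  let T : List ((ℕ × β) × Bool) :=
    (List.range N).flatMap fun i => (Finset.univ : Finset β).toList.map fun c => ((i, c), f c i)
  have hT : ∀ i c b, ((i, c), b) ∈ T ↔ i < N ∧ f c i = b := by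
    intro i c b
    simp [T]
  let compat : ℕ → (List β × β × List Bool) → Prop := fun i y =>
    ((i, y.2.1), y.2.2.getD i false) ∈ T ∨
      (N ≤ i ∧ (y.2.2.getD i false = false ∨ y.1[i]? = some y.2.1))
  have hcompat : PrimrecRel compat := by
    have hi : Primrec fun x : ℕ × (List β × β × List Bool) => x.1 := Primrec.fst
    have hσ : Primrec fun x : ℕ × (List β × β × List Bool) => x.2.1 :=
      Primrec.fst.comp Primrec.snd
    have hc : Primrec fun x : ℕ × (List β × β × List Bool) => x.2.2.1 :=
      Primrec.fst.comp (Primrec.snd.comp Primrec.snd)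
    have hτ : Primrec fun x : ℕ × (List β × β × List Bool) => x.2.2.2.getD x.1 false :=
      (Primrec.list_getD false).comp (Primrec.snd.comp (Primrec.snd.comp Primrec.snd)) hi
    exact ((primrecPred_mem_list T).comp ((hi.pair hc).pair hτ)).or
      ((Primrec.nat_le.comp (Primrec.const N) hi).and
        ((Primrec.eq.comp hτ (Primrec.const false)).or
          (Primrec.eq.comp (Primrec.list_getElem?.comp hσ hi) (Primrec.option_some.comp hc))))
  have hall : PrimrecPred fun y : List β × β × List Bool => ∀ i < y.2.2.length, compat i y :=
    (hcompat.forall_mem_list.comp (Primrec.list_range.comp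
      (Primrec.list_length.comp (Primrec.snd.comp Primrec.snd))) Primrec.id).of_eq (by simp)
  refine ⟨fun x => ∃ y : β × List Bool, (∀ i < y.2.length, compat i (x.2, y)) ∧ R (x.1, y),
    ?_, fun p => ?_⟩
  · refine REPred.exists' (p := fun z : (P × List β) × β × List Bool =>
      (∀ i < z.2.2.length, compat i (z.1.2, z.2)) ∧ R (z.1.1, z.2)) (REPred.and ?_ ?_)
    · exact (hall.comp ((Primrec.snd.comp Primrec.fst).pair Primrec.snd)).computablePred.to_re
    · exact hR.comp ((Computable.fst.comp Computable.fst).pair Computable.snd)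
  · ext X
    simp only [Set.mem_ofPred_eq, Prod.exists, not_exists, not_and]
    constructor
    · intro h k c τ hτ hRτ
      -- Past the end of `τ`, follow the stem up to `N` and add nothing beyond, so the coloring
      -- imposes no further constraint.
      let G : ℕ → Bool := fun i => if i < τ.length then τ.getD i false else
        if i < N then f c i else false
      have hG : initSeg G τ.length = τ := by
        refine List.ext_getElem (by simp) fun n h1 h2 => ?_
        simp [initSeg, G, h2]
      refine h c G ⟨fun i hi => ?_, fun i hi hGi => ?_⟩ τ.length (by rwa [hG])
      · by_cases hl : i < τ.length
        · rcases hτ i hl with h | h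
          · simp only [hT] at h
            simp only [G, hl, if_true]
            exact h.2.symm
          · omega
        · simp [G, hl, hi]
      · by_cases hl : i < τ.length
        · simp only [G, hl, if_true] at hGi
          rcases hτ i hl with h | h
          · simp only [hT] at h
            omega
          · rcases h.2 with h | h
            · exact absurd (hGi.symm.trans h) (by simp)
            · exact (seg_getElem?_eq_some.1 h).2
        · simp [G, hl, hi.not_gt] at hGi
    · intro h c G hG k hR
      refine h k c (initSeg G k) (fun i hi => ?_) hR
      rw [initSeg_length] at hi
      have hGi : (initSeg G k).getD i false = G i := by simp [initSeg, hi]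
      simp only [compat, hGi, hT, seg_getElem?_eq_some]
      by_cases hN : i < N
      · exact Or.inl ⟨hN, (hG.1 i hN).symm⟩
      · refine Or.inr ⟨not_lt.1 hN, ?_⟩
        cases hb : G i
        · exact Or.inl rfl
        · exact Or.inr ⟨hi, hG.2 i (not_lt.1 hN) hb⟩

end Computability

/-! ### Diagonalization and incompatible valuations. -/

namespace Computability

/-- The diagonal partial recursive function with Boolean values. -/
def diag (n : ℕ) : Part Bool :=
  ((Denumerable.ofNat Nat.Partrec.Code n).eval n).map fun y => decide (y = Encodable.encode true)

theorem partrec_diag : Partrec diag := by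
  refine Partrec.map (Nat.Partrec.Code.eval_part.comp (Computable.ofNat _) Computable.id) ?_
  exact (Primrec.eq.comp Primrec.snd (Primrec.const _)).decide.to_comp.to₂

theorem rePred_mem_diag : REPred fun x : ℕ × Bool => x.2 ∈ diag x.1 := by
  have h1 : Partrec fun x : ℕ × Bool => diag x.1 := partrec_diag.comp Computable.fst
  have h2 : REPred fun y : (ℕ × Bool) × Bool => y.1.2 = y.2 :=
    (Primrec.eq.comp (Primrec.snd.comp Primrec.fst) Primrec.snd).computablePred.to_re
  refine ((Partrec.bind h1 (Partrec.to₂ h2)).dom_re).of_eq fun x => ?_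
  simp only [Part.dom_iff_mem, Part.mem_bind_iff, Part.mem_assert_iff]
  constructor
  · rintro ⟨-, a, ha, hx, -⟩
    rwa [hx]
  · exact fun h => ⟨(), _, h, rfl, by simp⟩

/-- The class of two-valued diagonally noncomputable functions. -/
def diagAvoiding : Set (ℕ → Bool) :=
  {X | ∀ n, X n ∉ diag n}

/-- A code for `X`, taken as the input, is evaluated by `diag` at itself. -/
theorem exists_mem_diag_of_computable {X : ℕ → Bool} (hX : Computable X) : ∃ n, X n ∈ diag n := by
  obtain ⟨c, hc⟩ := Nat.Partrec.Code.exists_code.1 (Partrec.nat_iff.1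
    (Computable.encode.comp hX).partrec)
  refine ⟨Encodable.encode c, ?_⟩
  rw [diag, Denumerable.ofNat_encode, hc]
  refine (Part.mem_map_iff _).2 ⟨_, Part.mem_some _, ?_⟩
  cases h : X (Encodable.encode c) <;> simp [h]

theorem diagAvoiding_nonempty : diagAvoiding.Nonempty := by
  classical
  refine ⟨fun n => if true ∈ diag n then false else true, fun n h => ?_⟩
  dsimp only at h
  split_ifs at h with ht
  · exact absurd (Part.mem_unique h ht) (by simp)
  · exact ht h

theorem isPi01Class_diagAvoiding : IsPi01Class diagAvoiding := by
  obtain ⟨W, hW, hC⟩ := EffClosed.forall_not (P := Unit)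
    (rePred_mem_diag.comp (f := fun x : Unit × ℕ × Bool => x.2) Computable.snd)
  refine ⟨fun τ => W ((), τ), hW.comp ((Computable.const ()).pair Computable.id), ?_⟩
  ext X
  have := Set.ext_iff.1 (hC ()) X
  simp only [Set.mem_ofPred_eq] at this
  simp only [diagAvoiding, Set.mem_compl_iff, Set.mem_ofPred_eq, this]
  simp [seg, initSeg]

theorem not_isPADegree_of_computable {X : ℕ → Bool} (hX : Computable X) :
    ¬ IsPADegree {n | X n = true} := by
  intro h
  obtain ⟨Y, hY, hYX⟩ := h _ isPi01Class_diagAvoiding diagAvoiding_nonempty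
  have : Computable Y := by
    refine RecursiveIn.partrec_of_oracle ?_ hYX
    rintro g rfl
    refine (((Primrec.dom_bool Bool.toNat).to_comp.comp hX).partrec).of_eq fun n => ?_
    cases hn : X n <;> simp [charOracle, hn]
  obtain ⟨n, hn⟩ := exists_mem_diag_of_computable this
  exact hY n hn

/-- A finite set of guesses that are all opposite to the diagonal function. -/
def Correct (p : List (ℕ × Bool)) : Prop :=
  ∀ x ∈ p, (!x.2) ∈ diag x.1

theorem rePred_correct : REPred Correct := by
  refine REPred.forall_mem_list (α := List (ℕ × Bool)) (l := id)
    (p := fun y : List (ℕ × Bool) × (ℕ × Bool) => (!y.2.2) ∈ diag y.2.1) ?_ Primrec.id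
  exact rePred_mem_diag.comp ((Primrec.fst.comp Primrec.snd).pair
    (Primrec.not.comp (Primrec.snd.comp Primrec.snd))).to_comp

/-- If every `n` failed, c.e. choice would give a computable `g` such that `(n, g n)` is completed
to a member of `V` by a correct list. The negation of `g` meets `diag` at some `n`; there the
extended list is itself correct, contrary to the hypothesis. -/
theorem exists_forall_cons_notMem {V : List (ℕ × Bool) → Prop} (hV : REPred V)
    (h : ∀ p, Correct p → ¬ V p) : ∃ n, ∀ v p, Correct p → ¬ V ((n, v) :: p) := by
  by_contra hcon
  push Not at hcon
  have hR : REPred fun x : ℕ × Bool => ∃ p, Correct p ∧ V (x :: p) :=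
    REPred.exists' (p := fun z : (ℕ × Bool) × List (ℕ × Bool) => Correct z.2 ∧ V (z.1 :: z.2))
      ((rePred_correct.comp Computable.snd).and
        (hV.comp (Computable.list_cons.comp Computable.fst Computable.snd)))
  obtain ⟨g, hg, hgR⟩ := hR.exists_computable_choice hcon
  obtain ⟨n, hn⟩ := exists_mem_diag_of_computable (Primrec.not.to_comp.comp hg)
  obtain ⟨p, hp, hVp⟩ := hgR n
  refine h _ ?_ hVp
  intro x hx
  rcases List.mem_cons.1 hx with rfl | hx
  · exact hn
  · exact hp x hx

/-- Iterates the one-point case: once a position is found, projecting out its guess leaves a c.e.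
set that still has no correct member. -/
theorem exists_forall_zip_notMem (r : ℕ) {V : List (ℕ × Bool) → Prop} (hV : REPred V)
    (h : ∀ p, Correct p → ¬ V p) : ∃ L : List ℕ, L.length = r ∧
      ∀ s : List Bool, s.length = r → ∀ p, Correct p → ¬ V (L.zip s ++ p) := by
  induction r generalizing V with
  | zero => exact ⟨[], rfl, fun s _ p hp => by simpa using h p hp⟩
  | succ r ih =>
    obtain ⟨n, hn⟩ := exists_forall_cons_notMem hV h
    obtain ⟨L, hL, hLs⟩ := ih (V := fun p => ∃ v, V ((n, v) :: p))
      (REPred.exists' (p := fun z : List (ℕ × Bool) × Bool => V ((n, z.2) :: z.1))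
        (hV.comp (Computable.list_cons.comp ((Computable.const n).pair Computable.snd)
          Computable.fst)))
      (fun p hp ⟨v, hv⟩ => hn v p hp hv)
    refine ⟨n :: L, by simp [hL], fun s hs p hp hVs => ?_⟩
    obtain ⟨v, s, rfl⟩ := List.exists_cons_of_length_eq_add_one hs
    exact hLs s (by simpa using hs) p hp ⟨v, by simpa using hVs⟩

/-- A c.e. set of valuations without correct members misses arbitrarily many pairwise
incompatible valuations. -/
theorem exists_incompatible (r : ℕ) {V : List (ℕ × Bool) → Prop} (hV : REPred V)
    (h : ∀ p, Correct p → ¬ V p) : ∃ q : (Fin r → Bool) → List (ℕ × Bool),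
      (∀ s, ¬ V (q s)) ∧ ∀ s t, s ≠ t → ∃ n v, (n, v) ∈ q s ∧ (n, !v) ∈ q t := by
  obtain ⟨L, hL, hLs⟩ := exists_forall_zip_notMem r hV h
  refine ⟨fun s => L.zip (List.ofFn s), fun s => ?_, fun s t hst => ?_⟩
  · simpa using hLs (List.ofFn s) (by simp) [] (by simp [Correct])
  · obtain ⟨i, hi⟩ := Function.ne_iff.1 hst
    have key : ∀ u : Fin r → Bool, (L[i.1]'(by omega), u i) ∈ L.zip (List.ofFn u) := by
      intro u
      refine List.mem_iff_getElem.2 ⟨i, by simp [hL], by simp⟩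
    refine ⟨_, _, key s, ?_⟩
    have : (!s i) = t i := by
      revert hi
      cases s i <;> cases t i <;> simp
    rw [this]
    exact key t

end Computability

/-! ### Forcing conditions and the density lemmas. -/

namespace Computability

/-- A forcing condition: finitely many parts `a`, each with a finite stem for either side `b` of
the partition `A`, and a nonempty effectively closed class of colorings, the elements colored `a`
being the reservoir of the part `a`. -/
structure Condition (A : ℕ → Bool) where
  m : ℕ
  N : ℕ
  stem : Fin m → Bool → ℕ → Bool
  C : Set (ℕ → Fin m)
  effClosed : EffClosed fun _ : Unit => C
  nonempty : C.Nonempty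
  stem_sub : ∀ a b n, stem a b n = true → n < N ∧ A n = b

namespace Condition

variable {A : ℕ → Bool}

/-- `G` satisfies the side `b` of the part `a` of the condition `c`. -/
def Adm (c : Condition A) (a : Fin c.m) (b : Bool) (G : ℕ → Bool) : Prop :=
  ∃ X ∈ c.C, Agrees (c.stem a b) c.N X a G

/-- A part some reservoir of which meets both sides of the partition in an infinite set. -/
def Acceptable (c : Condition A) (a : Fin c.m) : Prop :=
  ∃ X ∈ c.C, ∀ b, {n | X n = a ∧ A n = b}.Infinite

/-- `d` extends `c`, the part `a` of `d` refining the part `f a` of `c`. -/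
structure Ext (d c : Condition A) (f : Fin d.m → Fin c.m) : Prop where
  le : c.N ≤ d.N
  adm : ∀ a b G, d.Adm a b G → c.Adm (f a) b G
  reservoir : ∀ a, ∀ X ∈ d.C, ∃ Y ∈ c.C, ∀ n, X n = a → Y n = f a

theorem Ext.refl (c : Condition A) : Ext c c id :=
  ⟨le_rfl, fun _ _ _ h => h, fun _ X hX => ⟨X, hX, fun _ h => h⟩⟩

theorem Ext.trans {e d c : Condition A} {g : Fin e.m → Fin d.m} {f : Fin d.m → Fin c.m}
    (h : Ext e d g) (h' : Ext d c f) : Ext e c (f ∘ g) where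
  le := h'.le.trans h.le
  adm a b G hG := h'.adm _ b G (h.adm a b G hG)
  reservoir a X hX := by
    obtain ⟨Y, hY, hXY⟩ := h.reservoir a X hX
    obtain ⟨Z, hZ, hYZ⟩ := h'.reservoir (g a) Y hY
    exact ⟨Z, hZ, fun n hn => hYZ n (hXY n hn)⟩

theorem adm_stem (c : Condition A) (a : Fin c.m) (b : Bool) : c.Adm a b (c.stem a b) := by
  obtain ⟨X, hX⟩ := c.nonempty
  exact ⟨X, hX, fun _ _ => rfl, fun i hi h => absurd (c.stem_sub a b i h).1 hi.not_gt⟩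

/-- The stem of `d` is admissible for `d`, hence for `c`, and admissible sets follow the stem of `c`
below `c.N`. -/
theorem Ext.stem_eq {d c : Condition A} {f : Fin d.m → Fin c.m} (h : Ext d c f) (a : Fin d.m)
    (b : Bool) {n : ℕ} (hn : n < c.N) : d.stem a b n = c.stem (f a) b n := by
  obtain ⟨X, -, hX, -⟩ := h.adm a b _ (d.adm_stem a b)
  exact hX n hn

theorem Ext.acceptable {d c : Condition A} {f : Fin d.m → Fin c.m} (h : Ext d c f) {a : Fin d.m}
    (ha : d.Acceptable a) : c.Acceptable (f a) := by
  obtain ⟨X, hX, hinf⟩ := ha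
  obtain ⟨Y, hY, hXY⟩ := h.reservoir a X hX
  exact ⟨Y, hY, fun b => (hinf b).mono fun n hn => ⟨hXY n hn.1, hn.2⟩⟩

/-- A property of parts inherited by refinements. -/
def Persistent (R : ∀ c : Condition A, Fin c.m → Prop) : Prop :=
  ∀ (d c : Condition A) (f : Fin d.m → Fin c.m), Ext d c f → ∀ a, R c (f a) → R d a

/-- If one can always reduce the number of parts without a persistent property, then one can reach
a condition all parts of which have it. -/
theorem exists_ext_forall {R : ∀ c : Condition A, Fin c.m → Prop}
    (h : ∀ (c : Condition A) (a : Fin c.m), ¬ R c a → ∃ d f, Ext d c f ∧ ((∀ a, R d a) ∨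
      {a | ¬ R d a}.ncard < {a | ¬ R c a}.ncard))
    (c : Condition A) : ∃ d f, Ext d c f ∧ ∀ a, R d a := by
  induction hk : {a | ¬ R c a}.ncard using Nat.strong_induction_on
    generalizing c with
  | _ k ih =>
    by_cases hc : ∀ a, R c a
    · exact ⟨c, id, Ext.refl c, hc⟩
    · push Not at hc
      obtain ⟨a, ha⟩ := hc
      obtain ⟨d, f, hd, hR | hlt⟩ := h c a ha
      · exact ⟨d, f, hd, hR⟩
      · obtain ⟨e, g, he, hR⟩ := ih _ (hk ▸ hlt) d rfl
        exact ⟨e, f ∘ g, he.trans hd, hR⟩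

/-- Restrict the class of a condition to a cylinder and extend the stems within it. -/
def restrict (c : Condition A) (X : ℕ → Fin c.m) (hX : X ∈ c.C) (N' : ℕ)
    (F : Fin c.m → Bool → ℕ → Bool) (hF : ∀ a b n, F a b n = true → n < N' ∧ A n = b) :
    Condition A where
  m := c.m
  N := N'
  stem := F
  C := c.C ∩ {Y | seg Y N' = seg X N'}
  effClosed := c.effClosed.inter (EffClosed.cylinder X N')
  nonempty := ⟨X, hX, rfl⟩
  stem_sub := hF

/-- The cylinder freezes colors below `N'`, so elements added to a stem using `X` keep their color
under every remaining coloring. -/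
theorem restrict_ext (c : Condition A) (X : ℕ → Fin c.m) (hX : X ∈ c.C) (N' : ℕ) (hN : c.N ≤ N')
    (F : Fin c.m → Bool → ℕ → Bool) (hF : ∀ a b n, F a b n = true → n < N' ∧ A n = b)
    (hA : ∀ a b, Agrees (c.stem a b) c.N X a (F a b)) : Ext (c.restrict X hX N' F hF) c id where
  le := hN
  adm := by
    rintro a b G ⟨Y, ⟨hY, hYX⟩, h1, h2⟩
    refine ⟨Y, hY, fun i hi => (h1 i (hi.trans_le hN)).trans ((hA a b).1 i hi), fun i hi hG => ?_⟩
    by_cases hiN : i < N'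
    · rw [seg_congr.1 hYX i hiN]
      exact (hA a b).2 i hi ((h1 i hiN).symm.trans hG)
    · exact h2 i (not_lt.1 hiN) hG
  reservoir _ Y hY := ⟨Y, hY.1, fun _ h => h⟩

theorem restrict_card_lt {c : Condition A} {X : ℕ → Fin c.m} {hX : X ∈ c.C} {N' : ℕ}
    {F : Fin c.m → Bool → ℕ → Bool} {hF : ∀ a b n, F a b n = true → n < N' ∧ A n = b}
    {R : ∀ c : Condition A, Fin c.m → Prop} (hR : Persistent R)
    (hext : Ext (c.restrict X hX N' F hF) c id) {a : Fin c.m} (ha : ¬ R c a)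
    (ha' : R (c.restrict X hX N' F hF) a) :
    {a | ¬ R (c.restrict X hX N' F hF) a}.ncard <
      {a | ¬ R c a}.ncard := by
  refine Set.ncard_lt_ncard (s := {x : Fin c.m | ¬ R (c.restrict X hX N' F hF) x})
    ⟨fun x hx h => hx (hR _ _ _ hext x h), fun h => h ha ha'⟩ (Set.toFinite _)

/-- The part `a` is not acceptable or both its stems have elements beyond `s`. -/
def Grown (s : ℕ) (c : Condition A) (a : Fin c.m) : Prop :=
  c.Acceptable a → ∀ b, ∃ n, s ≤ n ∧ c.stem a b n = true

theorem persistent_grown (s : ℕ) : Persistent (A := A) (Grown s) := by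
  intro d c f h a hR ha b
  obtain ⟨n, hn, hs⟩ := hR (h.acceptable ha) b
  exact ⟨n, hn, by rw [h.stem_eq a b (c.stem_sub _ _ _ hs).1, hs]⟩

/-- An acceptable part has a coloring whose reservoir supplies elements of both sides beyond any
bound; adding one to each stem repairs this part and harms no other. -/
theorem exists_ext_grown (s : ℕ) (c : Condition A) : ∃ d f, Ext d c f ∧ ∀ a, Grown s d a := by
  classical
  refine exists_ext_forall (fun c a hR => ?_) c
  have hacc : c.Acceptable a := by
    by_contra h
    exact hR fun h' => absurd h' h
  obtain ⟨X, hX, hinf⟩ := hacc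
  choose n hn hnN using fun b => (hinf b).exists_gt (max s c.N)
  have hsn : ∀ b, s < n b := fun b => (le_max_left _ _).trans_lt (hnN b)
  have hNn : ∀ b, c.N < n b := fun b => (le_max_right _ _).trans_lt (hnN b)
  let N' := max (n true) (n false) + 1
  have hnN' : ∀ b, n b < N' := by
    intro b
    cases b <;> simp only [N'] <;> omega
  have hN' : c.N ≤ N' := ((hNn true).trans (hnN' true)).le
  let F : Fin c.m → Bool → ℕ → Bool := fun a' b i => c.stem a' b i || decide (a' = a ∧ i = n b)
  have hF : ∀ a' b i, F a' b i = true ↔ c.stem a' b i = true ∨ (a' = a ∧ i = n b) := by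
    simp [F]
  have hF' : ∀ a' b i, F a' b i = true → i < N' ∧ A i = b := by
    intro a' b i hi
    rcases (hF _ _ _).1 hi with hi | ⟨-, rfl⟩
    · exact ⟨(c.stem_sub _ _ _ hi).1.trans_le hN', (c.stem_sub _ _ _ hi).2⟩
    · exact ⟨hnN' b, (hn b).2⟩
  have hext : Ext (c.restrict X hX N' F hF') c id := by
    refine restrict_ext c X hX N' hN' F hF' fun a' b => ⟨fun i hi => ?_, fun i hi h => ?_⟩
    · have := hNn b
      have : i ≠ n b := by omega
      simp [F, this]
    · rcases (hF _ _ _).1 h with h | ⟨rfl, rfl⟩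
      · exact absurd (c.stem_sub _ _ _ h).1 hi.not_gt
      · exact (hn b).1
  refine ⟨_, _, hext, Or.inr (restrict_card_lt (persistent_grown s) hext hR ?_)⟩
  exact fun _ b => ⟨n b, (hsn b).le, (hF _ _ _).2 (Or.inr ⟨rfl, rfl⟩)⟩

/-- The part `a` guarantees that on some side `b` the relation enumerated by `E` is not the graph
of a diagonally noncomputable function. -/
def Decides (E : Bool × List Bool × ℕ × Bool → Prop) (c : Condition A) (a : Fin c.m) : Prop :=
  ∃ b, (∃ n v k, v ∈ diag n ∧ k ≤ c.N ∧ E (b, initSeg (c.stem a b) k, n, v)) ∨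
    ∃ n, ∀ G, c.Adm a b G → ∀ k v, ¬ E (b, initSeg G k, n, v)

theorem persistent_decides (E : Bool × List Bool × ℕ × Bool → Prop) :
    Persistent (A := A) (Decides E) := by
  rintro d c f h a ⟨b, ⟨n, v, k, hv, hk, hE⟩ | ⟨n, hn⟩⟩
  · refine ⟨b, Or.inl ⟨n, v, k, hv, hk.trans h.le, ?_⟩⟩
    rwa [initSeg_congr.2 fun i hi => h.stem_eq a b (hi.trans_le hk)]
  · exact ⟨b, Or.inr ⟨n, fun G hG => hn G (h.adm a b G hG)⟩⟩

/-- Colorings that split the parts in `U` so that no set homogeneous for the splitting forces `E`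
to disagree with the valuation `p`. -/
def splittings (c : Condition A) (U : Set (Fin c.m)) (E : Bool × List Bool × ℕ × Bool → Prop)
    (p : List (ℕ × Bool)) : Set (ℕ → Fin c.m × Bool) :=
  {X | Prod.fst ∘ X ∈ c.C} ∩ {X | ∀ x G, Agrees (c.stem x.1 x.2) c.N X x G → ∀ k,
    ¬ (x.1 ∈ U ∧ ∃ y, y ∈ p ∧ E (x.2, initSeg G k, y.1, !y.2))}

theorem effClosed_splittings (c : Condition A) (U : Set (Fin c.m))
    {E : Bool × List Bool × ℕ × Bool → Prop} (hE : REPred E) :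
    EffClosed (c.splittings U E) := by
  refine EffClosed.inter ((c.effClosed.preimage Primrec.fst).param (Computable.const ())) ?_
  refine EffClosed.forall_agrees (R := fun z : List (ℕ × Bool) × (Fin c.m × Bool) × List Bool =>
    z.2.1.1 ∈ U ∧ ∃ y, y ∈ z.1 ∧ E (z.2.1.2, z.2.2, y.1, !y.2)) (fun x => c.stem x.1 x.2) c.N ?_
  refine REPred.and ?_ (REPred.exists' (p := fun w : (List (ℕ × Bool) × (Fin c.m × Bool) ×
    List Bool) × (ℕ × Bool) => w.2 ∈ w.1.1 ∧ E (w.1.2.1.2, w.1.2.2, w.2.1, !w.2.2))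
    (REPred.and ?_ ?_))
  · exact ((primrecPred_finite fun a => a ∈ U).comp
      (Primrec.fst.comp (Primrec.fst.comp Primrec.snd))).computablePred.to_re
  · have : PrimrecRel fun (L : List (ℕ × Bool)) (y : ℕ × Bool) => ∃ x ∈ L, x = y :=
      PrimrecRel.exists_mem_list Primrec.eq
    exact ((this.comp (Primrec.fst.comp Primrec.fst) Primrec.snd).of_eq fun w => by
      simp).computablePred.to_re
  · refine hE.comp (Primrec.to_comp ?_)
    have h1 : Primrec fun w : (List (ℕ × Bool) × (Fin c.m × Bool) × List Bool) × (ℕ × Bool) =>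
      w.1.2 := Primrec.snd.comp Primrec.fst
    exact (Primrec.snd.comp (Primrec.fst.comp h1)).pair ((Primrec.snd.comp h1).pair
      ((Primrec.fst.comp Primrec.snd).pair (Primrec.not.comp (Primrec.snd.comp Primrec.snd))))

theorem exists_ext_of_correct (c : Condition A) {E : Bool × List Bool × ℕ × Bool → Prop}
    {p : List (ℕ × Bool)} (hp : Correct p)
    (he : c.splittings {a | ¬ Decides E c a} E p = ∅) :
    ∃ d f, Ext d c f ∧ {a | ¬ Decides E d a}.ncard <
      {a | ¬ Decides E c a}.ncard := by
  obtain ⟨X, hX⟩ := c.nonempty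
  -- The true partition is itself a splitting. Its failure yields a set whose new elements lie on
  -- the right side of `A`, which makes it usable as a stem.
  have hX' : (fun n => (X n, A n)) ∉ c.splittings {a | ¬ Decides E c a} E p := by
    simp [he]
  have h1 : ∃ x G, Agrees (c.stem x.1 x.2) c.N (fun n => (X n, A n)) x G ∧ ∃ k,
      ¬ Decides E c x.1 ∧ ∃ y, y ∈ p ∧ E (x.2, initSeg G k, y.1, !y.2) := by
    by_contra hcon
    push Not at hcon
    refine hX' ⟨hX, fun x G hG k => ?_⟩
    rintro ⟨hx, y, hy, hE⟩
    exact hcon x G hG k hx y hy hE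
  obtain ⟨⟨a, b⟩, G, ⟨hG1, hG2⟩, k, ha, y, hy, hE⟩ := h1
  dsimp only at hG1 hG2 ha hE
  -- Truncating `G` here keeps the old stem as well as the use `k` of the enumeration.
  let N' := max c.N k
  let F : Fin c.m → Bool → ℕ → Bool := fun a' b' n =>
    if a' = a ∧ b' = b then decide (n < N') && G n else c.stem a' b' n
  have hFab : ∀ n, F a b n = (decide (n < N') && G n) := by simp [F]
  have hF : ∀ a' b' n, F a' b' n = true → n < N' ∧ A n = b' := by
    intro a' b' n hn
    by_cases hab : a' = a ∧ b' = b
    · obtain ⟨rfl, rfl⟩ := hab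
      simp only [hFab, Bool.and_eq_true, decide_eq_true_eq] at hn
      refine ⟨hn.1, ?_⟩
      by_cases hnN : n < c.N
      · exact (c.stem_sub _ _ n ((hG1 n hnN).symm.trans hn.2)).2
      · exact congrArg Prod.snd (hG2 n (not_lt.1 hnN) hn.2)
    · simp only [F, hab, if_false] at hn
      exact ⟨(c.stem_sub _ _ n hn).1.trans_le (le_max_left _ _), (c.stem_sub _ _ n hn).2⟩
  have hext : Ext (c.restrict X hX N' F hF) c id := by
    refine restrict_ext c X hX N' (le_max_left _ _) F hF fun a' b' => ?_
    by_cases hab : a' = a ∧ b' = b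
    · obtain ⟨rfl, rfl⟩ := hab
      refine ⟨fun i hi => ?_, fun i hi h => ?_⟩
      · rw [hFab, hG1 i hi]
        simp [N', hi]
      · simp only [hFab, Bool.and_eq_true] at h
        exact congrArg Prod.fst (hG2 i hi h.2)
    · refine ⟨fun i hi => by simp [F, hab], fun i hi h => ?_⟩
      simp only [F, hab, if_false] at h
      exact absurd (c.stem_sub _ _ i h).1 hi.not_gt
  refine ⟨_, _, hext, restrict_card_lt (persistent_decides E) hext ha ?_⟩
  refine ⟨b, Or.inl ⟨y.1, !y.2, k, hp y hy, le_max_right _ _, ?_⟩⟩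
  have hseg : initSeg (F a b) k = initSeg G k := initSeg_congr.2 fun i hi => by
    rw [hFab]
    simp [N', hi]
  exact hseg ▸ hE

theorem exists_ext_of_incompatible (c : Condition A) {E : Bool × List Bool × ℕ × Bool → Prop}
    (hE : REPred E)
    (hp : ∀ p, Correct p → ¬ c.splittings {a | ¬ Decides E c a} E p = ∅) :
    ∃ d f, Ext d c f ∧ ∀ a, Decides E d a := by
  classical
  have hV := effClosed_splittings c {a | ¬ Decides E c a} hE
  -- There are `2 * c.m` split colors, and `2 ^ (2 * c.m)` valuations outnumber them.
  obtain ⟨q, hq, hinc⟩ := exists_incompatible (2 * c.m) hV.rePred_eq_empty hp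
  choose X hX using fun s => Set.nonempty_iff_ne_empty.2 (hq s)
  -- A color of the overlaid coloring records a split color for each valuation; it repeats one at
  -- two distinct valuations `s a` and `t a`.
  let e := (Fintype.equivFin ((Fin (2 * c.m) → Bool) → Fin c.m × Bool)).symm
  have hpig : ∀ a, ∃ s t, s ≠ t ∧ e a s = e a t := by
    intro a
    refine Fintype.exists_ne_map_eq_of_card_lt (e a) ?_
    simp only [Fintype.card_prod, Fintype.card_fin, Fintype.card_bool, Fintype.card_fun]
    rw [mul_comm]
    exact Nat.lt_two_pow_self
  choose s t hst heq using hpig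
  let d : Condition A :=
    { m := _
      N := c.N
      stem := fun a b => c.stem (e a (s a)).1 b
      C := ⋂ u, {Y | (fun a => e a u) ∘ Y ∈ c.splittings {a | ¬ Decides E c a} E (q u)}
      effClosed := EffClosed.iInter fun u =>
        (hV.preimage (Primrec.dom_finite _)).param (Computable.const (q u))
      nonempty := by
        refine ⟨fun n => e.symm fun u => X u n, Set.mem_iInter.2 fun u => ?_⟩
        have : ((fun a => e a u) ∘ fun n => e.symm fun u => X u n) = X u := by
          funext n
          simp
        simpa [this] using hX u
      stem_sub := fun a b n h => c.stem_sub _ b n h }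
  have hext : Ext d c fun a => (e a (s a)).1 := by
    refine ⟨le_rfl, ?_, ?_⟩
    · rintro a b G ⟨Y, hY, h1, h2⟩
      refine ⟨_, (Set.mem_iInter.1 hY (s a)).1, h1, fun i hi hG => ?_⟩
      simp [h2 i hi hG]
    · intro a Y hY
      refine ⟨_, (Set.mem_iInter.1 hY (s a)).1, fun n hn => ?_⟩
      simp [hn]
  refine ⟨d, _, hext, fun a => ?_⟩
  by_cases ha : Decides E c (e a (s a)).1
  · exact persistent_decides E _ _ _ hext a ha
  obtain ⟨n, v, hns, hnt⟩ := hinc _ _ (hst a)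
  refine ⟨(e a (s a)).2, Or.inr ⟨n, ?_⟩⟩
  rintro G ⟨Y, hY, h1, h2⟩ k w hw
  have hs := (Set.mem_iInter.1 hY (s a)).2 (e a (s a)) G
    ⟨h1, fun i hi hG => by simp [h2 i hi hG]⟩ k
  have ht := (Set.mem_iInter.1 hY (t a)).2 (e a (s a)) G
    ⟨h1, fun i hi hG => by simp [h2 i hi hG, heq]⟩ k
  -- Any value at `n` contradicts one of the two valuations, yet `G` is homogeneous for the
  -- splittings chosen for both.
  by_cases hwv : w = v
  · exact ht ⟨ha, _, hnt, by simpa [hwv] using hw⟩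
  · have : w = !v := by
      revert hwv
      cases w <;> cases v <;> simp
    exact hs ⟨ha, _, hns, by simpa [this] using hw⟩

theorem exists_ext_decides {E : Bool × List Bool × ℕ × Bool → Prop} (hE : REPred E)
    (c : Condition A) : ∃ d f, Ext d c f ∧ ∀ a, Decides E d a := by
  refine exists_ext_forall (fun c a _ => ?_) c
  by_cases h : ∃ p, Correct p ∧ c.splittings {a | ¬ Decides E c a} E p = ∅
  · obtain ⟨p, hp, he⟩ := h
    obtain ⟨d, f, hd, hlt⟩ := exists_ext_of_correct c hp he
    exact ⟨d, f, hd, Or.inr hlt⟩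
  · push Not at h
    obtain ⟨d, f, hd, hR⟩ := exists_ext_of_incompatible c hE fun p hp he =>
      (h p hp).ne_empty he
    exact ⟨d, f, hd, Or.inl hR⟩

end Condition

end Computability

/-! ### Acceptable parts, the generic pair and the conclusion. -/

namespace Computability

/-- A finitely branching tree with nodes on all levels has an infinite branch. -/
theorem exists_branch {T : ℕ → Type} [∀ n, Finite (T n)] [∀ n, Nonempty (T n)]
    (f : ∀ n, T (n + 1) → T n) : ∃ a : ∀ n, T n, ∀ n, f n (a (n + 1)) = a n := by
  let F := CategoryTheory.Functor.ofOpSequence (X := T) fun n => TypeCat.ofHom (f n)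
  have : ∀ j, Finite (F.obj j) := fun j => inferInstanceAs (Finite (T j.unop))
  have : ∀ j, Nonempty (F.obj j) := fun j => inferInstanceAs (Nonempty (T j.unop))
  obtain ⟨s, hs⟩ := nonempty_sections_of_finite_inverse_system F
  refine ⟨fun n => s (Opposite.op n), fun n => ?_⟩
  have := hs (CategoryTheory.homOfLE (Nat.le_add_right n 1)).op
  rw [CategoryTheory.Functor.ofOpSequence_map_homOfLE_succ] at this
  exact this

namespace Condition

variable {A : ℕ → Bool}

/-- If no part is acceptable, each coloring in the class determines almost all of `A` through a map
from colors to sides. There are countably many such maps and thresholds, so by Baire one pair works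
on a whole relative cylinder. There `A` can be computed by waiting for compactness to rule out the
wrong answer. -/
theorem exists_acceptable (hA : ¬ Computable A) (c : Condition A) : ∃ a, c.Acceptable a := by
  by_contra hcon
  have hfin : ∀ X ∈ c.C, ∃ x : (Fin c.m → Bool) × ℕ, ∀ n, x.2 ≤ n → A n = x.1 (X n) := by
    intro X hX
    have : ∀ a, ∃ b, {n | X n = a ∧ A n = b}.Finite := by
      intro a
      by_contra h
      push Not at h
      exact hcon ⟨a, X, hX, h⟩
    choose b hb using this
    obtain ⟨s, hs⟩ := (Set.finite_iUnion hb).bddAbove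
    -- Color `a` meets side `b a` only up to `s`, so later elements lie on the other side.
    refine ⟨(fun a => !b a, s + 1), fun n hn => ?_⟩
    by_contra h
    have h' : A n = b (X n) := by
      cases h1 : A n <;> cases h2 : b (X n) <;> simp_all
    have := hs (Set.mem_iUnion.2 ⟨X n, rfl, h'⟩)
    dsimp only at hn
    omega
  have hC : IsClosed c.C := c.effClosed.isClosed ()
  have : CompactSpace c.C := isCompact_iff_compactSpace.1 hC.isCompact
  have : Nonempty c.C := c.nonempty.to_subtype
  obtain ⟨⟨S, s⟩, X₀, hint⟩ := nonempty_interior_of_iUnion_of_closed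
    (f := fun x : (Fin c.m → Bool) × ℕ => {X : c.C | ∀ n, x.2 ≤ n → A n = x.1 (X.1 n)})
    (fun x => by
      have : {X : c.C | ∀ n, x.2 ≤ n → A n = x.1 (X.1 n)} =
          ⋂ n, ⋂ _ : x.2 ≤ n, (fun X : c.C => X.1 n) ⁻¹' {a | A n = x.1 a} := by
        ext X; simp
      rw [this]
      exact isClosed_iInter fun n => isClosed_iInter fun _ => (isClosed_discrete _).preimage
        ((continuous_apply n).comp continuous_subtype_val))
    (Set.eq_univ_of_forall fun X => Set.mem_iUnion.2 (hfin X.1 X.2))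
  obtain ⟨U, hU, hUo, hX₀U⟩ := mem_interior.1 hint
  obtain ⟨V, hV, rfl⟩ := isOpen_induced_iff.1 hUo
  obtain ⟨I, u, hu, hIV⟩ := isOpen_pi_iff.1 hV X₀.1 hX₀U
  let k := I.sup id + 1
  have hcyl : ∀ Y ∈ c.C, seg Y k = seg X₀.1 k → ∀ n, s ≤ n → A n = S (Y n) := by
    intro Y hY hYX
    refine hU (a := ⟨Y, hY⟩) (hIV fun i hi => ?_)
    have : Y i = X₀.1 i := seg_congr.1 hYX i (Nat.lt_succ_of_le (Finset.le_sup (f := id) hi))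
    exact (congrArg (· ∈ u i) this).mpr (hu i hi).2
  -- The colorings in the cylinder that predict `p.2` for membership of `p.1` in the partition.
  let D : ℕ × Bool → Set (ℕ → Fin c.m) := fun p =>
    (c.C ∩ {Y | seg Y k = seg X₀.1 k}) ∩ {Y | ∀ j, ¬ (j = p.1 ∧ ¬ S (Y j) = p.2)}
  have hD : EffClosed D := by
    refine EffClosed.inter (EffClosed.inter (c.effClosed.param (Computable.const ()))
      (EffClosed.cylinder X₀.1 k)) ?_
    refine EffClosed.forall_not (R := fun x : (ℕ × Bool) × ℕ × Fin c.m =>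
      x.2.1 = x.1.1 ∧ ¬ S x.2.2 = x.1.2) (PrimrecPred.computablePred ?_).to_re
    exact (Primrec.eq.comp (Primrec.fst.comp Primrec.snd) (Primrec.fst.comp Primrec.fst)).and
      (Primrec.eq.comp ((Primrec.dom_finite S).comp (Primrec.snd.comp Primrec.snd))
        (Primrec.snd.comp Primrec.fst)).not
  have hR : REPred fun x : ℕ × Bool =>
      x ∈ (List.range s).map (fun n => (n, A n)) ∨ (s ≤ x.1 ∧ D (x.1, !x.2) = ∅) := by
    refine REPred.or (primrecPred_mem_list _).computablePred.to_re (REPred.and ?_ ?_)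
    · exact (Primrec.nat_le.comp (Primrec.const s) Primrec.fst).computablePred.to_re
    · exact hD.rePred_eq_empty.comp (Primrec.fst.pair (Primrec.not.comp Primrec.snd)).to_comp
  obtain ⟨g, hg, hgR⟩ := hR.exists_computable_choice fun n => by
    refine ⟨A n, ?_⟩
    rcases lt_or_ge n s with hn | hn
    · exact Or.inl (by simpa using hn)
    · refine Or.inr ⟨hn, Set.eq_empty_iff_forall_notMem.2 ?_⟩
      rintro Y ⟨⟨hY, hYX⟩, hYn⟩
      refine hYn n ⟨rfl, ?_⟩
      rw [← hcyl Y hY hYX n hn]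
      simp
  refine hA (hg.of_eq fun n => ?_)
  rcases hgR n with h | ⟨hn, h⟩
  · simp only [List.mem_map, Prod.mk.injEq] at h
    obtain ⟨_, -, rfl, h⟩ := h
    exact h.symm
  · by_contra hne
    -- The member `X₀` always predicts correctly, so a true answer is never ruled out.
    have hX₀ : X₀.1 ∈ D (n, !g n) := by
      refine ⟨⟨X₀.2, rfl⟩, ?_⟩
      rintro j ⟨rfl, hj⟩
      rw [← hcyl X₀.1 X₀.2 rfl _ hn] at hj
      revert hj hne
      dsimp only
      cases A j <;> cases g j <;> simp
    simp [h] at hX₀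

/-- The condition with a single part and no commitments. -/
def trivial (A : ℕ → Bool) : Condition A where
  m := 1
  N := 0
  stem _ _ _ := false
  C := Set.univ
  effClosed := EffClosed.univ
  nonempty := Set.univ_nonempty
  stem_sub := by simp

theorem Ext.exists_le {c : ℕ → Condition A} {f : ∀ i, Fin (c (i + 1)).m → Fin (c i).m}
    (hf : ∀ i, Ext (c (i + 1)) (c i) (f i)) {a : ∀ i, Fin (c i).m}
    (ha : ∀ i, f i (a (i + 1)) = a i) {i j : ℕ} (hij : i ≤ j) :
    ∃ g, Ext (c j) (c i) g ∧ g (a j) = a i := by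
  induction j, hij using Nat.le_induction with
  | base => exact ⟨id, Ext.refl _, rfl⟩
  | succ j _ ih =>
    obtain ⟨g, hg, hga⟩ := ih
    exact ⟨g ∘ f j, (hf j).trans hg, by simp [ha, hga]⟩

/-- For a noncomputable partition there is a pair of infinite sets, one in either side, such that
every c.e. relation is decided by a condition satisfied by initial segments of the pair. -/
theorem exists_generic (hA : ¬ Computable A) : ∃ G : Bool → ℕ → Bool,
    (∀ b n, G b n = true → A n = b) ∧ (∀ b, {n | G b n = true}.Infinite) ∧
    ∀ E : Bool × List Bool × ℕ × Bool → Prop, REPred E →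
      ∃ b, (∃ n v k, v ∈ diag n ∧ E (b, initSeg (G b) k, n, v)) ∨
        ∃ n, ∀ k v, ¬ E (b, initSeg (G b) k, n, v) := by
  classical
  obtain ⟨E, hE⟩ := (REPred.countable (α := Bool × List Bool × ℕ × Bool)).exists_eq_range
    ⟨fun _ => True, (primrecPred_mem_list ([] : List (Bool × List Bool × ℕ × Bool))).not.of_eq
      (by simp) |>.computablePred.to_re⟩
  have hEre : ∀ i, REPred (E i) := fun i => by
    have : E i ∈ {p | REPred p} := hE ▸ Set.mem_range_self i
    exact this
  have step : ∀ (i : ℕ) (c : Condition A), ∃ d f, Ext d c f ∧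
      (∀ a, Grown i d a) ∧ ∀ a, Decides (E i) d a := by
    intro i c
    obtain ⟨d, f, hd, hg⟩ := exists_ext_grown i c
    obtain ⟨e, g, he, hdec⟩ := exists_ext_decides (hEre i) d
    exact ⟨e, f ∘ g, he.trans hd, fun a => persistent_grown i _ _ _ he a (hg _), hdec⟩
  choose next fn hext hgrown hdec using step
  let c : ℕ → Condition A := fun i => i.rec (trivial A) fun i c => next i c
  have hcs : ∀ i, Ext (c (i + 1)) (c i) (fn i (c i)) := fun i => hext i (c i)
  have : ∀ i, Nonempty {a // (c i).Acceptable a} := fun i =>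
    let ⟨a, ha⟩ := exists_acceptable hA (c i)
    ⟨⟨a, ha⟩⟩
  -- Acceptability passes to the refined part, so the acceptable parts form a finitely branching
  -- tree.
  obtain ⟨a', ha'⟩ := exists_branch (T := fun i => {a // (c i).Acceptable a})
    fun i a => ⟨fn i (c i) a.1, (hcs i).acceptable a.2⟩
  let a : ∀ i, Fin (c i).m := fun i => (a' i).1
  have ha : ∀ i, fn i (c i) (a (i + 1)) = a i := fun i => congrArg Subtype.val (ha' i)
  have hcoh : ∀ {i j}, i ≤ j → ∀ b n, n < (c i).N → (c j).stem (a j) b n = (c i).stem (a i) b n := by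
    intro i j hij b n hn
    obtain ⟨g, hg, hga⟩ := Ext.exists_le hcs ha hij
    rw [hg.stem_eq _ _ hn, hga]
  have hgr : ∀ i b, ∃ n, i ≤ n ∧ (c (i + 1)).stem (a (i + 1)) b n = true := fun i b =>
    hgrown i (c i) (a (i + 1)) (a' (i + 1)).2 b
  have hN : ∀ i, i < (c (i + 1)).N := by
    intro i
    obtain ⟨n, hn, hs⟩ := hgr i true
    exact hn.trans_lt ((c (i + 1)).stem_sub _ _ _ hs).1
  let G : Bool → ℕ → Bool := fun b n => decide (∃ i, (c i).stem (a i) b n = true)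
  have hG : ∀ i b n, n < (c i).N → G b n = (c i).stem (a i) b n := by
    intro i b n hn
    rw [Bool.eq_iff_iff]
    simp only [G, decide_eq_true_eq]
    refine ⟨fun ⟨j, hj⟩ => ?_, fun h => ⟨i, h⟩⟩
    rcases le_total i j with hij | hij
    · rwa [← hcoh hij b n hn]
    · rwa [hcoh hij b n ((c j).stem_sub _ _ _ hj).1]
  refine ⟨G, fun b n h => ?_, fun b => ?_, fun E' hE' => ?_⟩
  · obtain ⟨i, hi⟩ := of_decide_eq_true h
    exact ((c i).stem_sub _ _ _ hi).2
  · refine Set.infinite_of_forall_exists_gt fun i => ?_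
    obtain ⟨n, hn, hs⟩ := hgr (i + 1) b
    exact ⟨n, decide_eq_true ⟨i + 1 + 1, hs⟩, hn⟩
  · obtain ⟨i, rfl⟩ : E' ∈ Set.range E := hE ▸ hE'
    obtain ⟨b, ⟨n, v, k, hv, hk, h⟩ | ⟨n, h⟩⟩ := hdec i (c i) (a (i + 1))
    · refine ⟨b, Or.inl ⟨n, v, k, hv, ?_⟩⟩
      rwa [initSeg_congr.2 fun j hj => hG (i + 1) b j (hj.trans_le hk)]
    · refine ⟨b, Or.inr ⟨n, fun k v => ?_⟩⟩
      -- A stage after `E'` is decided whose stem already fixes `G` below `k`; that stem is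
      -- admissible for stage `i + 1`.
      let j := max (i + 1) (k + 1)
      have hkj : k ≤ (c j).N := by
        have h1 := hN (j - 1)
        have h2 : j - 1 + 1 = j := by omega
        rw [h2] at h1
        omega
      obtain ⟨g, hg, hga⟩ := Ext.exists_le hcs ha (le_max_left (i + 1) (k + 1))
      rw [initSeg_congr.2 fun l hl => hG j b l (hl.trans_le hkj)]
      refine h _ ?_ k v
      rw [← hga]
      exact hg.adm _ b _ ((c j).adm_stem _ b)

end Condition

theorem exists_infinite_not_isPADegree {A : ℕ → Bool} (hA : ¬ Computable A) :
    ∃ H : Set ℕ, H.Infinite ∧ (∃ b, ∀ n ∈ H, A n = b) ∧ ¬ IsPADegree H := by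
  obtain ⟨G, hGA, hinf, hdec⟩ := Condition.exists_generic hA
  by_contra hcon
  have hPA : ∀ b, IsPADegree {n | G b n = true} := by
    intro b
    by_contra h
    exact hcon ⟨_, hinf b, ⟨b, hGA b⟩, h⟩
  choose X hX hXG using fun b => hPA b _ isPi01Class_diagAvoiding diagAvoiding_nonempty
  choose E hE hEX using fun b => (hXG b).exists_graph
  -- Merging both sides into one relation turns the pair of computations into a single requirement.
  have hre : REPred fun x : Bool × List Bool × ℕ × Bool => E x.1 x.2 := by
    have h : ∀ b, REPred fun x : Bool × List Bool × ℕ × Bool => x.1 = b ∧ E b x.2 := fun b =>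
      (Primrec.eq.comp Primrec.fst (Primrec.const b)).computablePred.to_re.and
        ((hE b).comp Computable.snd)
    refine ((h true).or (h false)).of_eq ?_
    rintro ⟨b, x⟩
    cases b <;> simp
  obtain ⟨b, ⟨n, v, k, hv, h⟩ | ⟨n, h⟩⟩ := hdec _ hre
  · exact hX b n (((hEX b n v).2 ⟨k, h⟩).symm ▸ hv)
  · obtain ⟨k, hk⟩ := (hEX b n _).1 rfl
    exact h k _ hk

end Computability

theorem mainTheorem3 (A : Set ℕ) :
    ∃ H : Set ℕ, H.Infinite ∧ (H ⊆ A ∨ H ⊆ Aᶜ) ∧ ¬ Computability.IsPADegree H := by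
  classical
  by_cases hA : Computable fun n => decide (n ∈ A)
  · by_cases hinf : A.Infinite
    · refine ⟨A, hinf, Or.inl subset_rfl, ?_⟩
      simpa using Computability.not_isPADegree_of_computable hA
    · refine ⟨Aᶜ, (Set.not_infinite.1 hinf).infinite_compl, Or.inr subset_rfl, ?_⟩
      have := Computability.not_isPADegree_of_computable (Primrec.not.to_comp.comp hA)
      convert this using 2
      ext n
      simp
  · obtain ⟨H, hinf, ⟨b, hb⟩, hPA⟩ := Computability.exists_infinite_not_isPADegree hA
    refine ⟨H, hinf, ?_, hPA⟩
    cases b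
    · exact Or.inr fun n hn => of_decide_eq_false (hb n hn)
    · exact Or.inl fun n hn => of_decide_eq_true (hb n hn)
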